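/- A complex number $\alpha$ is said to satisfy the height reducing property if there is a finite set $F\subset\mathbb{Z}$ such that $\mathbb{Z}[\alpha]=F[\alpha]$, where, for a set $F\subseteq\mathbb{Z}$, $F[\alpha]=\{\sum_{j=0}^{n}\varepsilon_j\alpha^j : n\in\mathbb{N},\ (\varepsilon_0,\dots,\varepsilon_n)\in F^{n+1}\}$. For an algebraic number $\alpha\in\mathbb{C}$, conjugates and the degree $\deg(\alpha)$ are taken over $\mathbb{Q}$. If $\alpha\neq 0$, let $m(\alpha)$ be the greatest number $m\ge 0$ for which there are conjugates $\alpha_1,\dots,\alpha_m$ of $\alpha$ that are multiplicatively independent, i.e. such that $\prod_{j=1}^{m}\alpha_j^{k_j}=1$ with $k_1,\dots,k_m\in\mathbb{Z}$ implies $k_1=\dots=k_m=0$ (so $m(\alpha)=0$ exactly when $\alpha$ is a root of unity). Theorem. Let $\alpha$ be an algebraic number all of whose conjugates lie on the unit circle. If $m(\alpha)\ge \deg(\alpha)/2-1$ or $m(\alpha)=1$, then $\alpha$ satisfies the height reducing property. -/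

import Mathlib

/-- `polyValues F α` is the set `F[α]` of the values at `α` of the polynomials
`ε₀ + ε₁ x + ⋯ + εₙ xⁿ`, `n ∈ ℕ`, with all coefficients in `F`.
In particular `polyValues Set.univ α` is `ℤ[α]`. -/
def polyValues (F : Set ℤ) (α : ℂ) : Set ℂ :=
  {z | ∃ (n : ℕ) (ε : Fin (n + 1) → ℤ),
    (∀ j, ε j ∈ F) ∧ z = ∑ j, (ε j : ℂ) * α ^ (j : ℕ)}

/-- `α` satisfies the height reducing property: `ℤ[α] = F[α]` for some finite set `F ⊆ ℤ`. -/
def HeightReducing (α : ℂ) : Prop :=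
  ∃ F : Set ℤ, F.Finite ∧ polyValues Set.univ α = polyValues F α

/-- The non-zero complex numbers `a₁, …, aₘ` are multiplicatively independent: they satisfy no
non-trivial relation `∏ aᵢ ^ kᵢ = 1` with integer exponents. -/
def MultIndep {m : ℕ} (a : Fin m → ℂ) : Prop :=
  (∀ i, a i ≠ 0) ∧ ∀ k : Fin m → ℤ, ∏ i, a i ^ k i = 1 → ∀ i, k i = 0

/-- The numbers `m` for which `α` has `m` multiplicatively independent conjugates over `ℚ`. -/
def indepConjCounts (α : ℂ) : Set ℕ :=
  {m | ∃ a : Fin m → ℂ, (∀ i, IsConjRoot ℚ α (a i)) ∧ MultIndep a}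

/-- `m(α)`: the greatest number of multiplicatively independent conjugates of `α`. -/
noncomputable def maxIndepConj (α : ℂ) : ℕ :=
  sSup (indepConjCounts α)

/-- Multiplicatively independent numbers are distinct. -/
theorem MultIndep.injective {m : ℕ} {a : Fin m → ℂ} (h : MultIndep a) :
    Function.Injective a := by
  intro i j hij
  by_contra hne
  have h1 := h.2 (Pi.single i 1 - Pi.single j 1) (by
    simp only [Pi.sub_apply]
    rw [Finset.prod_congr rfl (fun x _ => zpow_sub₀ (h.1 x) _ _), Finset.prod_div_distrib]
    have key : ∀ l : Fin m, ∏ x, a x ^ (Pi.single l (1 : ℤ) : Fin m → ℤ) x = a l := by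
      intro l
      rw [Finset.prod_eq_single l]
      · simp
      · intro b _ hb
        simp [Pi.single_eq_of_ne hb]
      · simp
    rw [key, key, hij, div_self (h.1 j)]) i
  simp [Pi.single_eq_of_ne hne] at h1

/-- For algebraic `α` the maximum defining `m(α)` is attained. -/
theorem isGreatest_maxIndepConj {α : ℂ} (hα : IsAlgebraic ℚ α) :
    IsGreatest (indepConjCounts α) (maxIndepConj α) := by
  have hne : (indepConjCounts α).Nonempty :=
    ⟨0, Fin.elim0, fun i => i.elim0, fun i => i.elim0, fun _ _ i => i.elim0⟩
  have hb : BddAbove (indepConjCounts α) := by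
    refine ⟨((minpoly ℚ α).rootSet ℂ).ncard, ?_⟩
    rintro m ⟨a, ha, hi⟩
    have hsub : Set.range a ⊆ (minpoly ℚ α).rootSet ℂ := by
      rintro _ ⟨i, rfl⟩
      rw [Polynomial.mem_rootSet]
      exact ⟨minpoly.ne_zero hα.isIntegral, (ha i).aeval_eq_zero⟩
    have hc := Set.ncard_le_ncard hsub (Polynomial.rootSet_finite _ _)
    rwa [← Set.image_univ, Set.ncard_image_of_injective _ hi.injective, Set.ncard_univ,
      Nat.card_eq_fintype_card, Fintype.card_fin] at hc
  exact ⟨Nat.sSup_mem hne hb, fun _ h => le_csSup hb h⟩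

/-! Let `S` be the set of conjugates, `d` its size, `P` an integer multiple of the minimal
polynomial. Dividing by `X` modulo `P` writes `Q(β) = ε + β Q'(β)` on `S`, where `ε` is any
representative of `Q(0)` modulo `P(0)`. As `|β| = 1`, the energy `∑ |Q(β)|²` changes by `-2εs +
dε²`, where `s = ∑ Re Q(β)` is the trace. Taking `ε ≠ 0` with the sign of `s`, a large trace forces
the energy down. If `d` consecutive traces are small, then up to bounded errors they are the moments
`∑ β⁻ʲ Q(β)`, `j < d`, and inverting a Vandermonde system bounds every `Q(β)`. So the energy is
bounded at arbitrarily late times (`exists_sum_norm_sq_bound`), by when the degree is below `d`.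
Only finitely many such `Q` exist, and their coefficients serve as final digits
(`exists_finite_digits`). -/

/-! ### Lagrange interpolation bounds -/

open Polynomial in
/-- A function on a finite set of non-zero complex numbers is controlled by its moments of order
less than the cardinality of the set. -/
theorem exists_norm_le_of_moments (S : Finset ℂ) :
    ∃ C : ℝ, 0 ≤ C ∧ ∀ (v : ℂ → ℂ) (M : ℝ), 0 ≤ M →
      (∀ j < S.card, ‖∑ β ∈ S, β⁻¹ ^ j * v β‖ ≤ M) → ∀ γ ∈ S, ‖v γ‖ ≤ C * M := by
  have hinj : Set.InjOn (fun β : ℂ => β⁻¹) S := inv_injective.injOn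
  -- The coefficients of the Lagrange basis at the nodes `β⁻¹` invert the Vandermonde matrix of the
  -- moments.
  let c : ℂ → ℂ[X] := fun γ => Lagrange.basis S (fun β : ℂ => β⁻¹) γ
  refine ⟨∑ γ ∈ S, ∑ j ∈ Finset.range S.card, ‖(c γ).coeff j‖, by positivity, ?_⟩
  intro v M hM h γ hγ
  have hdeg : (c γ).natDegree < S.card := by
    have hpos : 0 < S.card := Finset.card_pos.2 ⟨γ, hγ⟩
    have := Polynomial.natDegree_eq_of_degree_eq_some (Lagrange.degree_basis hinj hγ)
    change (c γ).natDegree = S.card - 1 at this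
    omega
  have hv : v γ = ∑ j ∈ Finset.range S.card, (c γ).coeff j * ∑ β ∈ S, β⁻¹ ^ j * v β := by
    calc v γ = ∑ β ∈ S, (c γ).eval β⁻¹ * v β := by
          rw [Finset.sum_eq_single γ]
          · rw [show (c γ).eval γ⁻¹ = 1 from Lagrange.eval_basis_self hinj hγ, one_mul]
          · intro β hβ hne
            rw [show (c γ).eval β⁻¹ = 0 from
              Lagrange.eval_basis_of_ne (v := fun β : ℂ => β⁻¹) hne.symm hβ, zero_mul]
          · exact fun h => (h hγ).elim
      _ = ∑ β ∈ S, ∑ j ∈ Finset.range S.card, (c γ).coeff j * (β⁻¹ ^ j * v β) := by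
          refine Finset.sum_congr rfl fun β _ => ?_
          rw [Polynomial.eval_eq_sum_range' hdeg, Finset.sum_mul]
          exact Finset.sum_congr rfl fun j _ => mul_assoc _ _ _
      _ = _ := by
          rw [Finset.sum_comm]
          exact Finset.sum_congr rfl fun j _ => (Finset.mul_sum _ _ _).symm
  calc ‖v γ‖ ≤ ∑ j ∈ Finset.range S.card, ‖(c γ).coeff j‖ * M := by
        rw [hv]
        refine norm_sum_le_of_le _ fun j hj => ?_
        rw [norm_mul]
        exact mul_le_mul_of_nonneg_left (h j (Finset.mem_range.1 hj)) (norm_nonneg _)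
    _ = (∑ j ∈ Finset.range S.card, ‖(c γ).coeff j‖) * M := (Finset.sum_mul _ _ _).symm
    _ ≤ _ := mul_le_mul_of_nonneg_right
        (Finset.single_le_sum (f := fun γ => ∑ j ∈ Finset.range S.card, ‖(c γ).coeff j‖)
          (fun _ _ => by positivity) hγ) hM

open Polynomial in
/-- Only finitely many integer polynomials of degree less than `#S` are bounded by `B` on `S`. -/
theorem finite_setOf_norm_aeval_le (S : Finset ℂ) (B : ℝ) :
    {Q : ℤ[X] | Q.natDegree < S.card ∧ ∀ β ∈ S, ‖aeval β Q‖ ≤ B}.Finite := by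
  let c : ℂ → ℂ[X] := fun γ => Lagrange.basis S id γ
  let D : ℝ := ∑ j ∈ Finset.range S.card, ∑ β ∈ S, |B| * ‖(c β).coeff j‖
  let f : ℤ[X] → Fin S.card → ℤ := fun Q i => Q.coeff i
  refine Set.Finite.of_injOn (f := f) (t := Set.Icc (fun _ => -⌈D⌉) (fun _ => ⌈D⌉)) ?_ ?_
    (Set.finite_Icc _ _)
  · rintro Q ⟨hdeg, hQ⟩
    have hcoeff : ∀ i : Fin S.card, |Q.coeff i| ≤ ⌈D⌉ := by
      intro i
      have hlt : (Q.map (algebraMap ℤ ℂ)).degree < S.card :=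
        degree_map_le.trans_lt (degree_le_natDegree.trans_lt (by exact_mod_cast hdeg))
      have hint := Lagrange.eq_interpolate (s := S) (v := id) Function.injective_id.injOn hlt
      have hci : ((Q.coeff i : ℤ) : ℂ) = ∑ β ∈ S, aeval β Q * (c β).coeff i := by
        have := congrArg (fun p => p.coeff (i : ℕ)) hint
        simp only [Lagrange.interpolate_apply, finsetSum_coeff, coeff_map, coeff_C_mul, id_eq,
          eval_map_algebraMap] at this
        exact this
      have h1 : ((|Q.coeff i| : ℤ) : ℝ) ≤ D := by
        calc ((|Q.coeff i| : ℤ) : ℝ) = ‖((Q.coeff i : ℤ) : ℂ)‖ := by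
              rw [Complex.norm_intCast, Int.cast_abs]
          _ ≤ ∑ β ∈ S, |B| * ‖(c β).coeff i‖ := by
              rw [hci]
              refine norm_sum_le_of_le _ fun β hβ => ?_
              rw [norm_mul]
              exact mul_le_mul_of_nonneg_right ((hQ β hβ).trans (le_abs_self B)) (norm_nonneg _)
          _ ≤ D := Finset.single_le_sum
              (f := fun j => ∑ β ∈ S, |B| * ‖(c β).coeff j‖)
              (fun _ _ => by positivity) (Finset.mem_range.2 i.2)
      exact_mod_cast h1.trans (Int.le_ceil D)
    exact ⟨fun i => (abs_le.1 (hcoeff i)).1, fun i => (abs_le.1 (hcoeff i)).2⟩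
  · rintro Q ⟨hQ, -⟩ R ⟨hR, -⟩ h
    ext i
    by_cases hi : i < S.card
    · exact congrFun h ⟨i, hi⟩
    · rw [coeff_eq_zero_of_natDegree_lt (by omega), coeff_eq_zero_of_natDegree_lt (by omega)]

/-! ### The digit step -/

/-- Every residue class modulo `a ≠ 0` has a non-zero representative of absolute value at most `|a|`
and of prescribed sign. -/
theorem exists_signed_residue (q : ℤ) {a : ℤ} (ha : a ≠ 0) (s : ℝ) :
    ∃ ε k : ℤ, q = ε + k * a ∧ |ε| ≤ |a| ∧ |s| ≤ ε * s := by
  have hpos : 0 < |a| := abs_pos.2 ha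
  have key : ∀ q : ℤ, ∃ ε k : ℤ, q = ε + k * a ∧ |ε| ≤ |a| ∧ 1 ≤ ε := by
    intro q
    -- Shifting by one puts the residue in `[1, |a|]` and so excludes the digit 0.
    have h0 := Int.emod_nonneg (q - 1) ha
    have h1 := Int.emod_lt_abs (q - 1) ha
    have h2 := Int.emod_add_mul_ediv (q - 1) a
    refine ⟨(q - 1) % a + 1, (q - 1) / a, by linarith, ?_, by omega⟩
    rw [abs_of_nonneg (by omega : 0 ≤ (q - 1) % a + 1)]
    omega
  rcases le_total 0 s with hs | hs
  · obtain ⟨ε, k, h1, h2, h3⟩ := key q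
    have : (1 : ℝ) ≤ ε := by exact_mod_cast h3
    exact ⟨ε, k, h1, h2, by rw [abs_of_nonneg hs]; nlinarith⟩
  · obtain ⟨ε, k, h1, h2, h3⟩ := key (-q)
    have : (1 : ℝ) ≤ ε := by exact_mod_cast h3
    refine ⟨-ε, -k, by linarith, by rwa [abs_neg], ?_⟩
    rw [abs_of_nonpos hs]
    push_cast
    nlinarith

open Polynomial in
/-- Division of `Q` by `X` modulo `P`, with a remainder `ε` whose sign is that of `s`. -/
theorem exists_digit_step {P : ℤ[X]} (hP : P.coeff 0 ≠ 0) (Q : ℤ[X]) (s : ℝ) :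
    ∃ (Q' : ℤ[X]) (ε : ℤ), (∀ β : ℂ, aeval β P = 0 → aeval β Q = ε + β * aeval β Q') ∧
      Q'.natDegree ≤ max Q.natDegree P.natDegree - 1 ∧ |ε| ≤ |P.coeff 0| ∧ |s| ≤ ε * s := by
  obtain ⟨ε, k, hq, hε, hs⟩ := exists_signed_residue (Q.coeff 0) hP s
  refine ⟨(Q - C k * P).divX, ε, ?_, ?_, hε, hs⟩
  · intro β hβ
    have h := congrArg (aeval β) (divX_mul_X_add (Q - C k * P))
    have h0 : (Q - C k * P).coeff 0 = ε := by
      rw [coeff_sub, coeff_C_mul, hq]; ring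
    rw [h0] at h
    simp only [map_add, map_mul, map_sub, aeval_X, aeval_C, hβ, mul_zero, sub_zero] at h
    rw [← h]
    simp only [algebraMap_int_eq, eq_intCast]
    ring
  · rw [natDegree_divX_eq_natDegree_tsub_one]
    refine Nat.sub_le_sub_right ?_ 1
    exact (natDegree_sub_le _ _).trans (max_le_max le_rfl (natDegree_C_mul_le _ _))

/-! ### Energy and trace along an orbit -/

open Polynomial ComplexConjugate in
/-- The values of an integer polynomial on a set stable under conjugation have real sum. -/
theorem norm_sum_aeval_eq {S : Finset ℂ} (hconj : ∀ β ∈ S, conj β ∈ S) (Q : ℤ[X]) :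
    ‖∑ β ∈ S, aeval β Q‖ = |∑ β ∈ S, (aeval β Q : ℂ).re| := by
  have hreal : conj (∑ β ∈ S, aeval β Q) = ∑ β ∈ S, (aeval β Q : ℂ) := by
    rw [map_sum]
    refine Finset.sum_nbij' (fun β => conj β) (fun β => conj β) hconj hconj
      (fun β _ => Complex.conj_conj β) (fun β _ => Complex.conj_conj β) fun β _ => ?_
    have := (aeval_algHom_apply ((starRingEnd ℂ).toIntAlgHom) β Q)
    exact this.symm
  obtain ⟨r, hr⟩ := Complex.conj_eq_iff_real.1 hreal
  rw [← Complex.re_sum, hr, Complex.norm_real, Complex.ofReal_re, Real.norm_eq_abs]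

open Polynomial in
/-- Effect of one step on the sum of the squares of the absolute values. -/
theorem sum_norm_sq_step_le {S : Finset ℂ} (hS : ∀ β ∈ S, ‖β‖ = 1) {Q Q' : ℤ[X]} {ε : ℤ} {K : ℝ}
    (hstep : ∀ β ∈ S, aeval β Q = ε + β * aeval β Q') (hK : |(ε : ℝ)| ≤ K)
    (hs : |∑ β ∈ S, (aeval β Q : ℂ).re| ≤ ε * ∑ β ∈ S, (aeval β Q : ℂ).re) :
    ∑ β ∈ S, ‖(aeval β Q' : ℂ)‖ ^ 2 ≤ ∑ β ∈ S, ‖(aeval β Q : ℂ)‖ ^ 2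
      - 2 * |∑ β ∈ S, (aeval β Q : ℂ).re| + S.card * K ^ 2 := by
  have h : ∀ β ∈ S, ‖(aeval β Q' : ℂ)‖ ^ 2 =
      ‖(aeval β Q : ℂ)‖ ^ 2 - 2 * (ε * (aeval β Q : ℂ).re) + (ε : ℝ) ^ 2 := by
    intro β hβ
    have h1 : ‖(aeval β Q' : ℂ)‖ = ‖(aeval β Q : ℂ) - ε‖ := by
      rw [hstep β hβ, add_sub_cancel_left, norm_mul, hS β hβ, one_mul]
    rw [h1, ← Complex.normSq_eq_norm_sq, ← Complex.normSq_eq_norm_sq, Complex.normSq_apply,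
      Complex.normSq_apply]
    simp only [Complex.sub_re, Complex.sub_im, Complex.intCast_re, Complex.intCast_im]
    ring
  rw [Finset.sum_congr rfl h, Finset.sum_add_distrib, Finset.sum_sub_distrib, ← Finset.mul_sum,
    ← Finset.mul_sum, Finset.sum_const, nsmul_eq_mul]
  have h2 : (ε : ℝ) ^ 2 ≤ K ^ 2 := sq_le_sq' (by linarith [(abs_le.1 hK).1]) (abs_le.1 hK).2
  have h3 : (S.card : ℝ) * (ε : ℝ) ^ 2 ≤ S.card * K ^ 2 :=
    mul_le_mul_of_nonneg_left h2 (Nat.cast_nonneg _)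
  linarith

/-- A non-negative sequence that cannot decrease by `1` over `d` steps forever takes small values
arbitrarily late. -/
theorem exists_le_of_decrease {N : ℕ → ℝ} (hN : ∀ n, 0 ≤ N n) {B : ℝ} {d : ℕ}
    (h : ∀ n, B < N n → N (n + d) ≤ N n - 1) (n₀ : ℕ) : ∃ n, n₀ ≤ n ∧ N n ≤ B := by
  by_contra! hc
  have key : ∀ k : ℕ, N (n₀ + k * d) ≤ N n₀ - k := by
    intro k
    induction k with
    | zero => simp
    | succ k ih =>
      have := h _ (hc (n₀ + k * d) (Nat.le_add_right _ _))
      rw [show n₀ + (k + 1) * d = n₀ + k * d + d by ring]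
      push_cast
      linarith
  obtain ⟨k, hk⟩ := exists_nat_gt (N n₀)
  linarith [key k, hN (n₀ + k * d)]

open Polynomial ComplexConjugate in
/-- There is a bound such that each orbit of digit steps meets it arbitrarily late. -/
theorem exists_sum_norm_sq_bound {S : Finset ℂ} (hS : ∀ β ∈ S, ‖β‖ = 1)
    (hconj : ∀ β ∈ S, conj β ∈ S) (K : ℝ) (hK : 0 ≤ K) :
    ∃ B : ℝ, ∀ (Q : ℕ → ℤ[X]) (ε : ℕ → ℤ),
      (∀ n, ∀ β ∈ S, aeval β (Q n) = ε n + β * aeval β (Q (n + 1))) →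
      (∀ n, |(ε n : ℝ)| ≤ K) →
      (∀ n, |∑ β ∈ S, (aeval β (Q n) : ℂ).re| ≤ ε n * ∑ β ∈ S, (aeval β (Q n) : ℂ).re) →
      ∀ n₀, ∃ n, n₀ ≤ n ∧ ∑ β ∈ S, ‖(aeval β (Q n) : ℂ)‖ ^ 2 ≤ B := by
  obtain ⟨C, hC, hmom⟩ := exists_norm_le_of_moments S
  set d := S.card
  -- One trace above `M` outweighs the growth of at most `d * K ^ 2` in each of `d` steps, with a
  -- net loss of at least 1.
  set M : ℝ := d * (d * K ^ 2) + 1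
  have hM0 : 0 ≤ M := by positivity
  refine ⟨d * (C * (M + d * (d * K))) ^ 2, fun Q ε hstep hε hs n₀ => ?_⟩
  refine exists_le_of_decrease (N := fun n => ∑ β ∈ S, ‖(aeval β (Q n) : ℂ)‖ ^ 2) (d := d)
    (fun n => by positivity) (fun n hn => ?_) n₀
  have hN := fun m => sum_norm_sq_step_le hS (hstep m) (hε m) (hs m)
  have hgrow : ∀ m j : ℕ, ∑ β ∈ S, ‖(aeval β (Q (m + j)) : ℂ)‖ ^ 2 ≤
      ∑ β ∈ S, ‖(aeval β (Q m) : ℂ)‖ ^ 2 + j * (d * K ^ 2) := by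
    intro m j
    induction j with
    | zero => simp
    | succ j ih =>
      have h1 := hN (m + j)
      have h2 := abs_nonneg (∑ β ∈ S, (aeval β (Q (m + j)) : ℂ).re)
      rw [← add_assoc]
      push_cast
      linarith
  by_cases hlarge : ∃ j < d, M < |∑ β ∈ S, (aeval β (Q (n + j)) : ℂ).re|
  · obtain ⟨j, hj, hMj⟩ := hlarge
    have h1 := hgrow n j
    have h2 := hN (n + j)
    have h3 := hgrow (n + j + 1) (d - (j + 1))
    rw [show n + j + 1 + (d - (j + 1)) = n + d by omega, Nat.cast_sub hj] at h3
    push_cast at h3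
    have : ((d : ℝ) - (j + 1)) * (d * K ^ 2) = d * (d * K ^ 2) - j * (d * K ^ 2) - d * K ^ 2 := by
      ring
    nlinarith [mul_nonneg (Nat.cast_nonneg (α := ℝ) d) (mul_nonneg (Nat.cast_nonneg (α := ℝ) d)
      (sq_nonneg K))]
  · push Not at hlarge
    refine absurd hn (not_lt.2 ?_)
    -- Unrolling `j` steps subtracts `j` digits times powers of `β⁻¹`, each of modulus at most `K`.
    have hdiff : ∀ β ∈ S, ∀ j : ℕ,
        ‖β⁻¹ ^ j * aeval β (Q n) - aeval β (Q (n + j))‖ ≤ j * K := by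
      intro β hβ j
      have hβ0 : β ≠ 0 := norm_ne_zero_iff.1 (by rw [hS β hβ]; exact one_ne_zero)
      induction j with
      | zero => simp
      | succ j ih =>
        have h1 : β⁻¹ ^ (j + 1) * aeval β (Q n) - aeval β (Q (n + (j + 1))) =
            β⁻¹ * (β⁻¹ ^ j * aeval β (Q n) - aeval β (Q (n + j))) + β⁻¹ * ε (n + j) := by
          rw [hstep (n + j) β hβ, ← add_assoc, mul_sub, mul_add, inv_mul_cancel_left₀ hβ0]
          ring
        rw [h1]
        refine (norm_add_le _ _).trans ?_
        rw [norm_mul, norm_mul, norm_inv, hS β hβ, inv_one, one_mul, one_mul,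
          Complex.norm_intCast]
        push_cast
        linarith [hε (n + j)]
    have hmoment : ∀ j < d, ‖∑ β ∈ S, β⁻¹ ^ j * (aeval β (Q n) : ℂ)‖ ≤ M + d * (d * K) := by
      intro j hj
      have h1 : ∑ β ∈ S, β⁻¹ ^ j * (aeval β (Q n) : ℂ) = ∑ β ∈ S, (aeval β (Q (n + j)) : ℂ) +
          ∑ β ∈ S, (β⁻¹ ^ j * aeval β (Q n) - aeval β (Q (n + j))) := by
        rw [← Finset.sum_add_distrib]
        exact Finset.sum_congr rfl fun β _ => by ring
      rw [h1]
      refine (norm_add_le _ _).trans (add_le_add ?_ ?_)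
      · rw [norm_sum_aeval_eq hconj]
        exact hlarge j hj
      · refine (norm_sum_le_of_le S fun β hβ => hdiff β hβ j).trans ?_
        rw [Finset.sum_const, nsmul_eq_mul]
        have : (j : ℝ) ≤ d := by exact_mod_cast hj.le
        gcongr
    have hval := hmom (fun β => aeval β (Q n)) _ (by positivity) hmoment
    calc ∑ β ∈ S, ‖(aeval β (Q n) : ℂ)‖ ^ 2
        ≤ ∑ β ∈ S, (C * (M + d * (d * K))) ^ 2 :=
          Finset.sum_le_sum fun β hβ => pow_le_pow_left₀ (norm_nonneg _) (hval β hβ) 2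
      _ = _ := by rw [Finset.sum_const, nsmul_eq_mul]

/-! ### Finite digit sets and the height reducing property -/

open Polynomial ComplexConjugate in
/-- Modulo a polynomial with non-zero constant term and simple roots, all on the unit circle, every
integer polynomial is congruent to one with coefficients in a fixed finite set. -/
theorem exists_finite_digits {S : Finset ℂ} (hS : ∀ β ∈ S, ‖β‖ = 1)
    (hconj : ∀ β ∈ S, conj β ∈ S) {P : ℤ[X]} (hroot : ∀ β ∈ S, aeval β P = 0)
    (hdeg : P.natDegree = S.card) (hpos : 0 < S.card) (hP : P.coeff 0 ≠ 0) :
    ∃ F : Set ℤ, F.Finite ∧ ∀ Q : ℤ[X], ∃ W : ℤ[X], (∀ i, W.coeff i ∈ F) ∧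
      ∀ β ∈ S, aeval β W = aeval β Q := by
  obtain ⟨B, hB⟩ := exists_sum_norm_sq_bound hS hconj (|P.coeff 0| : ℤ)
    (by exact_mod_cast abs_nonneg _)
  have hfin := finite_setOf_norm_aeval_le S (√B)
  set R := {Q : ℤ[X] | Q.natDegree < S.card ∧ ∀ β ∈ S, ‖aeval β Q‖ ≤ √B}
  -- The interval holds the digits of the steps, the union the coefficients of the possible final
  -- remainders.
  let F : Set ℤ := Set.Icc (-|P.coeff 0|) |P.coeff 0| ∪ ⋃ Q ∈ R, Set.range Q.coeff
  refine ⟨F, (Set.finite_Icc _ _).union (hfin.biUnion fun Q _ => ?_), fun Q₀ => ?_⟩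
  · refine ((Q.support.finite_toSet.image Q.coeff).insert 0).subset ?_
    rintro _ ⟨i, rfl⟩
    by_cases hi : Q.coeff i = 0
    · exact Or.inl hi
    · exact Or.inr ⟨i, mem_support_iff.2 hi, rfl⟩
  choose T e hT hTdeg he hs using
    fun Q : ℤ[X] => exists_digit_step hP Q (∑ β ∈ S, (aeval β Q : ℂ).re)
  have hback : ∀ (n : ℕ) (Q : ℤ[X]),
      (∃ W : ℤ[X], (∀ i, W.coeff i ∈ F) ∧ ∀ β ∈ S, aeval β W = aeval β (T^[n] Q)) →
      ∃ W : ℤ[X], (∀ i, W.coeff i ∈ F) ∧ ∀ β ∈ S, aeval β W = aeval β Q := by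
    intro n
    induction n with
    | zero => exact fun Q h => h
    | succ n ih =>
      intro Q h
      obtain ⟨W, hW, hWQ⟩ := ih (T Q) (by simpa only [Function.iterate_succ_apply] using h)
      refine ⟨C (e Q) + X * W, fun i => ?_, fun β hβ => ?_⟩
      · cases i with
        | zero =>
          rw [coeff_add, coeff_C_zero, mul_coeff_zero, coeff_X_zero, zero_mul, add_zero]
          exact Or.inl (abs_le.1 (he Q))
        | succ i =>
          rw [coeff_add, coeff_C_succ, coeff_X_mul, zero_add]
          exact hW i
      · rw [hT Q β (hroot β hβ), ← hWQ β hβ]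
        simp
  have hiter : ∀ n, (T^[n] Q₀).natDegree ≤ max (Q₀.natDegree - n) (S.card - 1) := by
    intro n
    induction n with
    | zero => simp
    | succ n ih =>
      rw [Function.iterate_succ_apply']
      have := hTdeg (T^[n] Q₀)
      omega
  -- After `Q₀.natDegree` steps only the bound `S.card - 1` on the degree remains.
  obtain ⟨n, hn, hnB⟩ := hB (fun n => T^[n] Q₀) (fun n => e (T^[n] Q₀))
    (fun n β hβ => by rw [Function.iterate_succ_apply']; exact hT _ β (hroot β hβ))
    (fun n => by exact_mod_cast he _) (fun n => hs _) Q₀.natDegree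
  refine hback n Q₀ ⟨T^[n] Q₀, fun i => Or.inr ?_, fun β _ => rfl⟩
  refine Set.mem_biUnion (x := T^[n] Q₀) ⟨?_, fun β hβ => ?_⟩ ⟨i, rfl⟩
  · have := hiter n
    omega
  · refine Real.le_sqrt_of_sq_le (le_trans ?_ hnB)
    exact Finset.single_le_sum (f := fun β => ‖(aeval β (T^[n] Q₀) : ℂ)‖ ^ 2)
      (fun _ _ => by positivity) hβ

open Polynomial in
/-- `F[α]` as the set of values of polynomials with coefficients in `F`. -/
theorem aeval_mem_polyValues {F : Set ℤ} {W : ℤ[X]} (hW : ∀ i, W.coeff i ∈ F) (α : ℂ) :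
    aeval α W ∈ polyValues F α := by
  refine ⟨W.natDegree, fun j => W.coeff j, fun j => hW j, ?_⟩
  rw [aeval_eq_sum_range, Finset.sum_range]
  simp [zsmul_eq_mul]

open Polynomial ComplexConjugate in
/-- An algebraic number with all its conjugates on the unit circle satisfies the height reducing
property. -/
theorem heightReducing_of_norm_eq_one {α : ℂ} (halg : IsAlgebraic ℚ α)
    (hcircle : ∀ β : ℂ, IsConjRoot ℚ α β → ‖β‖ = 1) : HeightReducing α := by
  classical
  have hint : IsIntegral ℚ α := halg.isIntegral
  have hα0 : α ≠ 0 := norm_ne_zero_iff.1 (by rw [hcircle α IsConjRoot.refl]; exact one_ne_zero)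
  let S : Finset ℂ := ((minpoly ℚ α).rootSet ℂ).toFinset
  have hmem : ∀ β, β ∈ S ↔ aeval β (minpoly ℚ α) = 0 := fun β => by
    rw [Set.mem_toFinset, mem_rootSet_of_ne (minpoly.ne_zero hint)]
  have hαS : α ∈ S := (hmem α).2 (minpoly.aeval ℚ α)
  have hcard : S.card = (minpoly ℚ α).natDegree := by
    rw [Set.toFinset_card]
    exact card_rootSet_eq_natDegree (minpoly.irreducible hint).separable
      (IsAlgClosed.splits _)
  -- Clearing denominators may leave `P` non-monic; division by `X` only needs `P.coeff 0 ≠ 0`.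
  obtain ⟨b, hb, hmap⟩ := IsLocalization.integerNormalization_spec
    (nonZeroDivisors ℤ) (minpoly ℚ α)
  set P := IsLocalization.integerNormalization (nonZeroDivisors ℤ) (minpoly ℚ α)
  have hb0 : b ≠ 0 := nonZeroDivisors.ne_zero hb
  have hdeg : P.natDegree = S.card := by
    rw [hcard, ← natDegree_map_eq_of_injective (algebraMap ℤ ℚ).injective_int P, hmap,
      natDegree_smul _ hb0]
  have hP0 : P.coeff 0 ≠ 0 := by
    intro h
    have h1 : (P.map (algebraMap ℤ ℚ)).coeff 0 = 0 := by rw [coeff_map, h, map_zero]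
    rw [hmap, coeff_smul, smul_eq_zero] at h1
    exact h1.elim hb0 (minpoly.coeff_zero_ne_zero hint hα0)
  have hnorm : ∀ β ∈ S, ‖β‖ = 1 := fun β hβ =>
    hcircle β ((isConjRoot_iff_aeval_eq_zero hint).2 ((hmem β).1 hβ))
  have hconj : ∀ β ∈ S, conj β ∈ S := fun β hβ => by
    have h := aeval_algHom_apply (Complex.conjAe.toAlgHom.restrictScalars ℚ) β (minpoly ℚ α)
    rw [(hmem β).1 hβ, map_zero] at h
    exact (hmem _).2 h
  obtain ⟨F, hF, hdigits⟩ := exists_finite_digits hnorm hconj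
    (fun β hβ => IsLocalization.integerNormalization_aeval_eq_zero _ _ ((hmem β).1 hβ))
    hdeg (Finset.card_pos.2 ⟨α, hαS⟩) hP0
  refine ⟨F, hF, Set.Subset.antisymm ?_ ?_⟩
  · rintro _ ⟨n, ε, -, rfl⟩
    obtain ⟨W, hW, hWQ⟩ := hdigits (∑ j, C (ε j) * X ^ (j : ℕ))
    have hval := hWQ α hαS
    rw [map_sum] at hval
    simp only [map_mul, map_pow, aeval_X, eq_intCast, map_intCast] at hval
    rw [← hval]
    exact aeval_mem_polyValues hW α
  · rintro _ ⟨n, ε, -, rfl⟩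
    exact ⟨n, ε, fun _ => Set.mem_univ _, rfl⟩

theorem theorem2 (α : ℂ) (halg : IsAlgebraic ℚ α)
    (hcircle : ∀ β : ℂ, IsConjRoot ℚ α β → ‖β‖ = 1)
    (hm : ((minpoly ℚ α).natDegree : ℝ) / 2 - 1 ≤ (maxIndepConj α : ℝ) ∨ maxIndepConj α = 1) :
    HeightReducing α :=
  heightReducing_of_norm_eq_one halg hcircle
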